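/- Let $k$ be a field, let $n\ge 1$, and let $A=k[x_1,\dots,x_n]$ be the polynomial algebra in $n$ variables. For a point $P=(p_1,\dots,p_n)\in k^n$ let $M_P$ be the (simple) $A$-module $$M_P=A/(x_1-p_1,\dots,x_n-p_n).$$ Then for any two points $P,Q\in k^n$, the dimension over $k$ of the first Ext group of $A$-modules is $$\dim_k\operatorname{Ext}^1_A(M_P,M_Q)=\begin{cases}n, & P=Q,\\ 0, & P\neq Q.\end{cases}$$ -/

import Mathlib

/-- The ideal `(x₁ - p₁, …, xₙ - pₙ)` of `k[x₁, …, xₙ]` attached to a point `P = (p₁, …, pₙ)`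
of `kⁿ`. -/
noncomputable def pointIdeal {k : Type*} [Field k] {n : ℕ} (P : Fin n → k) :
    Ideal (MvPolynomial (Fin n) k) :=
  Ideal.span (Set.range fun i : Fin n => MvPolynomial.X i - MvPolynomial.C (P i))

/-- The module `M_P = k[x₁, …, xₙ] / (x₁ - p₁, …, xₙ - pₙ)`, as an object of the category of
`k[x₁, …, xₙ]`-modules. -/
noncomputable abbrev pointModule {k : Type*} [Field k] {n : ℕ} (P : Fin n → k) :
    ModuleCat (MvPolynomial (Fin n) k) :=
  ModuleCat.of (MvPolynomial (Fin n) k) (MvPolynomial (Fin n) k ⧸ pointIdeal P)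

open CategoryTheory Abelian MvPolynomial

section PointIdeal

variable {k : Type*} [Field k] {n : ℕ}

/-! Write `I_P` for the ideal of `P`. If `P = Q`, apply `Hom(-, M_P)` to `0 → I_P → A → M_P → 0`:
`A` is projective and restriction from `A` to `I_P` is zero, so `Ext¹ ≅ Hom(I_P, M_P)`. Directional
derivatives at `P` identify the latter with `kⁿ`. If `P ≠ Q`, some `p_i ≠ q_i`; both `X i - p_i` and
`X i - q_i` kill `Ext`, and their difference is a unit. -/

theorem X_sub_C_mem_pointIdeal (P : Fin n → k) (i : Fin n) : X i - C (P i) ∈ pointIdeal P :=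
  Ideal.subset_span ⟨i, rfl⟩

theorem eval_eq_zero_of_mem_pointIdeal {P : Fin n → k} {a : MvPolynomial (Fin n) k}
    (ha : a ∈ pointIdeal P) : eval P a = 0 := by
  have h : pointIdeal P ≤ RingHom.ker (eval P) := by
    refine Ideal.span_le.mpr ?_
    rintro _ ⟨i, rfl⟩
    simp [RingHom.mem_ker]
  exact h ha

theorem sub_C_eval_mem_pointIdeal (P : Fin n → k) (a : MvPolynomial (Fin n) k) :
    a - C (eval P a) ∈ pointIdeal P := by
  induction a using MvPolynomial.induction_on with
  | C r => simp
  | add p q hp hq => simpa [add_sub_add_comm] using add_mem hp hq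
  | mul_X p i hp =>
    have h : p * X i - C (eval P (p * X i)) =
        p * (X i - C (P i)) + (p - C (eval P p)) * C (P i) := by
      simp only [map_mul, eval_X]; ring
    rw [h]
    exact add_mem (Ideal.mul_mem_left _ _ (X_sub_C_mem_pointIdeal P i))
      (Ideal.mul_mem_right _ _ hp)

/-- The `A`-linear map `I_P → A / I_P` given by the directional derivative at `P` along `c`. -/
noncomputable def pointIdealDeriv (P c : Fin n → k) :
    pointIdeal P →ₗ[MvPolynomial (Fin n) k] MvPolynomial (Fin n) k ⧸ pointIdeal P where
  toFun g := Ideal.Quotient.mk _ (∑ i, C (c i) * pderiv i (g : MvPolynomial (Fin n) k))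
  map_add' g h := by
    simp [mul_add, Finset.sum_add_distrib]
  map_smul' a g := by
    -- In the Leibniz rule the term differentiating `a` is a multiple of `g ∈ I_P`, so it dies in
    -- the quotient.
    have h : ∑ i, C (c i) * pderiv i ((a • g : pointIdeal P) : MvPolynomial (Fin n) k) =
        a * ∑ i, C (c i) * pderiv i (g : MvPolynomial (Fin n) k) +
          (∑ i, C (c i) * pderiv i a) * g := by
      rw [Finset.mul_sum, Finset.sum_mul, ← Finset.sum_add_distrib]
      refine Finset.sum_congr rfl fun i _ => ?_
      rw [Submodule.coe_smul, smul_eq_mul, Derivation.leibniz, smul_eq_mul, smul_eq_mul]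
      ring
    rw [h, map_add, Ideal.Quotient.eq_zero_iff_mem.mpr (Ideal.mul_mem_left _ _ g.2), add_zero]
    rfl

theorem pointIdealDeriv_X_sub_C (P c : Fin n → k) (i : Fin n) :
    pointIdealDeriv P c ⟨X i - C (P i), X_sub_C_mem_pointIdeal P i⟩ =
      Ideal.Quotient.mk _ (C (c i)) := by
  simp only [pointIdealDeriv, LinearMap.coe_mk, AddHom.coe_mk]
  rw [Finset.sum_eq_single i (fun j _ hj => by simp [pderiv_X_of_ne hj.symm]) (by simp)]
  simp

theorem pointIdeal_linearMap_ext {M : Type*} [AddCommGroup M] [Module (MvPolynomial (Fin n) k) M]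
    {P : Fin n → k} {f g : pointIdeal P →ₗ[MvPolynomial (Fin n) k] M}
    (h : ∀ i, f ⟨X i - C (P i), X_sub_C_mem_pointIdeal P i⟩ =
      g ⟨X i - C (P i), X_sub_C_mem_pointIdeal P i⟩) : f = g := by
  have hle : pointIdeal P ≤ (LinearMap.eqLocus f g).map (pointIdeal P).subtype := by
    refine Ideal.span_le.mpr ?_
    rintro _ ⟨i, rfl⟩
    exact ⟨_, h i, rfl⟩
  refine LinearMap.ext fun x => ?_
  obtain ⟨y, hy, hyx⟩ := hle x.2
  rwa [← Subtype.ext hyx]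

/-- The inclusion `I_P → A` followed by the projection `A → A / I_P`. -/
noncomputable abbrev pointShortComplex (P : Fin n → k) :
    ShortComplex (ModuleCat (MvPolynomial (Fin n) k)) where
  X₁ := ModuleCat.of _ (pointIdeal P)
  X₂ := ModuleCat.of _ (MvPolynomial (Fin n) k)
  X₃ := pointModule P
  f := ModuleCat.ofHom (pointIdeal P).subtype
  g := ModuleCat.ofHom (pointIdeal P).mkQ
  zero := by
    ext x
    exact Ideal.Quotient.eq_zero_iff_mem.mpr x.2

theorem pointShortComplex_shortExact (P : Fin n → k) : (pointShortComplex P).ShortExact where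
  exact := (ShortComplex.ShortExact.moduleCat_exact_iff_function_exact _).mpr
    (LinearMap.exact_subtype_mkQ _)
  mono_f := (ModuleCat.mono_iff_injective _).mpr (pointIdeal P).injective_subtype
  epi_g := (ModuleCat.epi_iff_surjective _).mpr (pointIdeal P).mkQ_surjective

/-- `pointIdealDeriv`, as a `k`-linear map from directions to `Ext⁰`. -/
noncomputable def pointIdealDerivExt (P : Fin n → k) :
    (Fin n → k) →ₗ[k] Ext (pointShortComplex P).X₁ (pointModule P) 0 where
  toFun c := Ext.mk₀ (ModuleCat.ofHom (pointIdealDeriv P c))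
  map_add' c d := by
    rw [← Ext.mk₀_add, ← ModuleCat.ofHom_add]
    congr 2
    refine pointIdeal_linearMap_ext fun i => ?_
    simp only [LinearMap.add_apply, pointIdealDeriv_X_sub_C, Pi.add_apply, map_add]
  map_smul' r c := by
    rw [RingHom.id_apply, ← Ext.mk₀_smul]
    congr 1
    ext1
    refine pointIdeal_linearMap_ext fun i => ?_
    change pointIdealDeriv P (r • c) _ =
      algebraMap k (MvPolynomial (Fin n) k) r • pointIdealDeriv P c _
    simp only [pointIdealDeriv_X_sub_C, Pi.smul_apply, smul_eq_mul, map_mul]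
    rfl

/-- The values on the generators `X i - p_i` determine a map and, as `A / I_P = k`, are scalars; the
derivative along `c` takes the values `c i`. -/
theorem pointIdealDerivExt_bijective (P : Fin n → k) :
    Function.Bijective (pointIdealDerivExt P) := by
  refine (Ext.mk₀_bijective _ _).comp (f := fun c => ModuleCat.ofHom (pointIdealDeriv P c))
    ⟨fun c d hcd => funext fun i => ?_, fun f => ?_⟩
  · have h := LinearMap.congr_fun (congrArg ModuleCat.Hom.hom hcd)
      ⟨X i - C (P i), X_sub_C_mem_pointIdeal P i⟩
    change pointIdealDeriv P c _ = pointIdealDeriv P d _ at h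
    rw [pointIdealDeriv_X_sub_C, pointIdealDeriv_X_sub_C, Ideal.Quotient.eq] at h
    simpa [sub_eq_zero] using eval_eq_zero_of_mem_pointIdeal h
  · choose a ha using fun i : Fin n => Ideal.Quotient.mk_surjective
      (f.hom ⟨X i - C (P i), X_sub_C_mem_pointIdeal P i⟩)
    refine ⟨fun i => eval P (a i), ?_⟩
    ext1
    refine pointIdeal_linearMap_ext fun i => ?_
    refine (pointIdealDeriv_X_sub_C P _ i).trans ((ha i).symm.trans ?_).symm
    exact Ideal.Quotient.eq.mpr (sub_C_eval_mem_pointIdeal P (a i))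

/-- Restriction `Hom(A, A / I_P) → Hom(I_P, A / I_P)` vanishes. -/
theorem subtype_comp_eq_zero (P : Fin n → k) (f : (pointShortComplex P).X₂ ⟶ pointModule P) :
    (pointShortComplex P).f ≫ f = 0 := by
  ext1
  refine LinearMap.ext fun g => ?_
  change f.hom (g : MvPolynomial (Fin n) k) = 0
  have h : (g : MvPolynomial (Fin n) k) = (g : MvPolynomial (Fin n) k) • 1 := by simp
  rw [h, map_smul]
  obtain ⟨b, hb⟩ := Ideal.Quotient.mk_surjective (f.hom (1 : MvPolynomial (Fin n) k))
  refine (congrArg ((g : MvPolynomial (Fin n) k) • ·) hb.symm).trans ?_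
  exact Ideal.Quotient.eq_zero_iff_mem.mpr (Ideal.mul_mem_right b _ g.2)

theorem precomp_extClass_pointShortComplex_bijective (P : Fin n → k) :
    Function.Bijective ((pointShortComplex_shortExact P).extClass.precompOfLinear k
      (pointModule P) (add_zero 1)) := by
  constructor
  · refine (injective_iff_map_eq_zero _).mpr fun x hx => ?_
    -- By exactness the kernel consists of restrictions from `A`, which vanish.
    obtain ⟨y, rfl⟩ := Ext.contravariant_sequence_exact₁ (pointShortComplex_shortExact P) _ x
      (add_zero 1) hx
    obtain ⟨f, rfl⟩ := Ext.homEquiv₀.symm.surjective y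
    exact (Ext.mk₀_comp_mk₀ _ _).trans
      ((congrArg Ext.mk₀ (subtype_comp_eq_zero P f)).trans (Ext.mk₀_zero _ _))
  · have : Projective (pointShortComplex P).X₂ := inferInstance
    exact precomp_extClass_surjective_of_projective_X₂ _ (pointShortComplex_shortExact P) 0

theorem rank_ext_one_pointModule_self (P : Fin n → k) :
    Module.rank k (Ext (pointModule P) (pointModule P) 1) = n := by
  let e := LinearEquiv.ofBijective _ (pointIdealDerivExt_bijective P) ≪≫ₗ
    LinearEquiv.ofBijective _ (precomp_extClass_pointShortComplex_bijective P)
  have h := e.lift_rank_eq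
  simpa using h.symm

theorem smul_id_pointModule_eq_zero {P : Fin n → k} {a : MvPolynomial (Fin n) k}
    (ha : a ∈ pointIdeal P) : a • 𝟙 (pointModule P) = 0 := by
  ext1
  refine LinearMap.ext fun x => ?_
  obtain ⟨b, rfl⟩ := Ideal.Quotient.mk_surjective x
  exact Ideal.Quotient.eq_zero_iff_mem.mpr (Ideal.mul_mem_right b _ ha)

theorem subsingleton_ext_pointModule {P Q : Fin n → k} (hPQ : P ≠ Q) (m : ℕ) :
    Subsingleton (Ext (pointModule P) (pointModule Q) m) := by
  obtain ⟨i, hi⟩ := Function.ne_iff.mp hPQ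
  refine subsingleton_of_forall_eq 0 fun x => ?_
  have hP : (X i - C (P i) : MvPolynomial (Fin n) k) • x = 0 := by
    -- The action on `Ext` may be computed through either argument: here the first, for `hQ` the
    -- second.
    have h : (X i - C (P i) : MvPolynomial (Fin n) k) • x =
        (Ext.mk₀ ((X i - C (P i) : MvPolynomial (Fin n) k) • 𝟙 (pointModule P))).comp x
          (zero_add m) := by
      simp [Ext.mk₀_smul]
    rw [h, smul_id_pointModule_eq_zero (X_sub_C_mem_pointIdeal P i), Ext.mk₀_zero, Ext.zero_comp]
  have hQ : (X i - C (Q i) : MvPolynomial (Fin n) k) • x = 0 := by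
    rw [Ext.smul_eq_comp_mk₀, smul_id_pointModule_eq_zero (X_sub_C_mem_pointIdeal Q i),
      Ext.mk₀_zero, Ext.comp_zero]
  have hu : C ((P i - Q i)⁻¹) * ((X i - C (Q i)) - (X i - C (P i))) =
      (1 : MvPolynomial (Fin n) k) := by
    rw [sub_sub_sub_cancel_left, ← C_sub, ← C_mul, inv_mul_cancel₀ (sub_ne_zero.mpr hi), C_1]
  rw [← one_smul (MvPolynomial (Fin n) k) x, ← hu, mul_smul, sub_smul, hP, hQ, sub_zero, smul_zero]

end PointIdeal

theorem mainTheorem5 {k : Type*} [Field k] (n : ℕ) (hn : 1 ≤ n) (P Q : Fin n → k) :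
    (P = Q →
      Module.rank k (CategoryTheory.Abelian.Ext (pointModule P) (pointModule Q) 1) = n) ∧
    (P ≠ Q →
      Module.rank k (CategoryTheory.Abelian.Ext (pointModule P) (pointModule Q) 1) = 0) := by
  refine ⟨?_, fun h => ?_⟩
  · rintro rfl
    exact rank_ext_one_pointModule_self P
  · have := subsingleton_ext_pointModule h 1
    exact rank_subsingleton' k _
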